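/- Let $W$ be a complete (smooth, finite-dimensional, non-empty) Riemannian manifold without boundary. Let $\mathcal G\colon[0,\infty)\to(0,\infty)$ be of class $C^1$ and let $\gamma\colon W\to[0,\infty)$ be of class $C^2$. For $t\ge 0$ put $$I(t)=\int_0^t\frac{ds}{\sqrt{\mathcal G(s)}}+1,\qquad \psi(t)=\log I(t).$$ Here "$x\to\infty$ in $W$" means that $x$ leaves every compact subset of $W$, and "off a compact set" means on the complement of some compact subset of $W$. The pair $(\mathcal G,\gamma)$ is called an Omori–Yau pair for the Hessian, with constants $A,C>0$, if - (h.1) $\gamma(x)\to+\infty$ as $x\to\infty$ in $W$; - (h.2) $\mathcal G(0)>0$, $\mathcal G'(t)\ge 0$ for all $t\ge 0$, and $\int_0^{\infty}\frac{ds}{\sqrt{\mathcal G(s)}}=+\infty$; - (h.3) $|\nabla\gamma|\le A\,\sqrt{\mathcal G(\gamma)}\;I(\gamma)$ off a compact set; - (h.5) $\operatorname{Hess}\gamma\le C\,\sqrt{\mathcal G(\gamma)}\;I(\gamma)$ off a compact set, in the sense of quadratic forms. It is called an Omori–Yau pair for the Laplacian, with constants $A,B>0$, if it satisfies (h.1)–(h.3)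 and, instead of (h.5), - (h.4) $\Delta\gamma\le B\,\sqrt{\mathcal G(\gamma)}\;I(\gamma)$ off a compact set. **Theorem 4.5.** Let $u\in C^2(W)$ satisfy $$\lim_{x\to\infty}\frac{u(x)}{\psi(\gamma(x))}=0 .$$ 1. If $(\mathcal G,\gamma)$ is an Omori–Yau pair for the Hessian with constants $A,C$, then there is a sequence $(x_k)$ in $W$ such that for all $k\ge 1$ $$|\nabla u|(x_k)\le\frac Ak,\qquad \operatorname{Hess}u(x_k)(X,X)\le\frac Ck\,|X|^2\quad\text{for all }X\in T_{x_k}W,$$ and such that, if $u^*=\sup_W u<\infty$, then $u(x_k)\to u^*$ as $k\to\infty$. 2. If $(\mathcal G,\gamma)$ is an Omori–Yau pair for the Laplacian with constants $A,B$, then there is a sequence $(x_k)$ in $W$ such that for all $k\ge 1$ $$|\nabla u|(x_k)\le\frac Ak,\qquad \Delta u(x_k)\le\frac Bk,$$ and such that, if $u^*=\sup_W u<\infty$, then $u(x_k)\to u^*$ as $k\to\infty$. -/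

import Mathlib

open Set Filter Topology MeasureTheory Bundle
open scoped Manifold ContDiff Bundle

noncomputable section

namespace OmoriYau

/-- The Christoffel symbols of the first kind at `p` of a metric `g` on an open subset of a vector
space: `z ↦ (1/2) (∂_v g(w, z) + ∂_w g(v, z) - ∂_z g(v, w))`. -/
def christoffelFirst {E : Type*} [NormedAddCommGroup E] [NormedSpace ℝ E]
    (g : E → E →L[ℝ] E →L[ℝ] ℝ) (p v w : E) : E →L[ℝ] ℝ :=
  (1 / 2 : ℝ) • (fderiv ℝ g p v w + fderiv ℝ g p w v - ((fderiv ℝ g p).flip v).flip w)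

section Geometry

/-! In this section `W` is a manifold without boundary, modelled on the finite-dimensional real
vector space `E`, with a Riemannian metric, i.e. an inner product on each tangent space. -/

variable (E : Type*) [NormedAddCommGroup E] [NormedSpace ℝ E] [FiniteDimensional ℝ E]
  {W : Type*} [TopologicalSpace W] [ChartedSpace E W] [IsManifold 𝓘(ℝ, E) ∞ W]
  [RiemannianBundle (fun x : W ↦ TangentSpace 𝓘(ℝ, E) x)]

instance instFiniteDimensionalTangentSpace (x : W) :
    FiniteDimensional ℝ (TangentSpace 𝓘(ℝ, E) x) :=
  inferInstanceAs (FiniteDimensional ℝ E)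

instance instCompleteSpaceTangentSpace (x : W) : CompleteSpace (TangentSpace 𝓘(ℝ, E) x) :=
  FiniteDimensional.complete ℝ _

/-- The gradient of `u` at `x`: the tangent vector `∇u(x)` with `⟨∇u(x), v⟩ = du(x) v`. -/
def grad (u : W → ℝ) (x : W) : TangentSpace 𝓘(ℝ, E) x :=
  (InnerProductSpace.toDual ℝ (TangentSpace 𝓘(ℝ, E) x)).symm (mvfderiv 𝓘(ℝ, E) u x)

/-- The coordinate frame of the chart around `x`: for a point `y` of the coordinate domain, it
sends a coordinate vector `v` to the tangent vector with these coordinates at the point of `W`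
whose coordinates are `y`. -/
def chartFrame (x : W) (y : E) :
    E →L[ℝ] TangentSpace 𝓘(ℝ, E) ((extChartAt 𝓘(ℝ, E) x).symm y) :=
  (trivializationAt E (TangentSpace 𝓘(ℝ, E)) x).symmL ℝ ((extChartAt 𝓘(ℝ, E) x).symm y)

/-- The metric tensor `g_{ij}` in the chart around `x`, as a function of the coordinates `y`. -/
def chartMetric (x : W) (y : E) : E →L[ℝ] E →L[ℝ] ℝ :=
  (innerSL ℝ (E := TangentSpace 𝓘(ℝ, E) ((extChartAt 𝓘(ℝ, E) x).symm y))).bilinearComp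
    (chartFrame E x y) (chartFrame E x y)

/-- The coordinates of the tangent vectors at `x`, in the chart around `x`. -/
def chartCoord (x : W) : TangentSpace 𝓘(ℝ, E) x →L[ℝ] E :=
  (trivializationAt E (TangentSpace 𝓘(ℝ, E)) x).continuousLinearMapAt ℝ x

/-- The Christoffel symbols of the second kind `Γ(v, w) = Γ_{ij}^k v^i w^j ∂_k` at `x`, in the
chart around `x`, obtained from those of the first kind by raising the last index. -/
def christoffel (x : W) (v w : TangentSpace 𝓘(ℝ, E) x) : TangentSpace 𝓘(ℝ, E) x :=
  (InnerProductSpace.toDual ℝ (TangentSpace 𝓘(ℝ, E) x)).symm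
    ((christoffelFirst (chartMetric E x) (extChartAt 𝓘(ℝ, E) x x)
      (chartCoord E x v) (chartCoord E x w)).comp (chartCoord E x))

/-- The Riemannian Hessian `Hess u = ∇ du` of `u` at `x`:
`Hess u (∂_i, ∂_j) = ∂_i ∂_j u - Γ_{ij}^k ∂_k u`, in the chart around `x`. -/
def hess (u : W → ℝ) (x : W) (v w : TangentSpace 𝓘(ℝ, E) x) : ℝ :=
  fderiv ℝ (fderiv ℝ (u ∘ (extChartAt 𝓘(ℝ, E) x).symm)) (extChartAt 𝓘(ℝ, E) x x)
      (chartCoord E x v) (chartCoord E x w)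
    - mvfderiv 𝓘(ℝ, E) u x (christoffel E x v w)

/-- The Laplace-Beltrami operator: the trace of the Hessian with respect to the metric. -/
def laplacian (u : W → ℝ) (x : W) : ℝ :=
  ∑ i, hess E u x (stdOrthonormalBasis ℝ (TangentSpace 𝓘(ℝ, E) x) i)
    (stdOrthonormalBasis ℝ (TangentSpace 𝓘(ℝ, E) x) i)

end Geometry

/-- `∫₀ᵗ ds / √(G s) + 1`. -/
def growth (G : ℝ → ℝ) (t : ℝ) : ℝ := (∫ s in (0 : ℝ)..t, 1 / √(G s)) + 1

/-- `ψ(t) = log (∫₀ᵗ ds / √(G s) + 1)`. -/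
def psi (G : ℝ → ℝ) (t : ℝ) : ℝ := Real.log (growth G t)

section Pairs

variable (E : Type*) [NormedAddCommGroup E] [NormedSpace ℝ E] [FiniteDimensional ℝ E]
  {W : Type*} [TopologicalSpace W] [ChartedSpace E W] [IsManifold 𝓘(ℝ, E) ∞ W]
  [RiemannianBundle (fun x : W ↦ TangentSpace 𝓘(ℝ, E) x)]

/-- The conditions common to Omori-Yau pairs `(G, γ)` for the Hessian and for the Laplacian.
Only the values of `G` on `[0, ∞)` matter. The limit `x → ∞` in `W` is along the complements of
compact sets. -/
structure IsOmoriYauPrePair (G : ℝ → ℝ) (γ : W → ℝ) (A : ℝ) : Prop where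
  contDiffOn : ContDiffOn ℝ 1 G (Ici 0)
  pos : ∀ t, 0 ≤ t → 0 < G t
  contMDiff : ContMDiff 𝓘(ℝ, E) 𝓘(ℝ, ℝ) 2 γ
  nonneg : ∀ x, 0 ≤ γ x
  tendsto : Tendsto γ (cocompact W) atTop
  deriv_nonneg : ∀ t, 0 ≤ t → 0 ≤ derivWithin G (Ici 0) t
  integral_eq_top : Tendsto (fun t : ℝ ↦ ∫ s in (0 : ℝ)..t, 1 / √(G s)) atTop atTop
  const_pos : 0 < A
  grad_le : ∃ K : Set W, IsCompact K ∧ ∀ x ∉ K, ‖grad E γ x‖ ≤ A * √(G (γ x)) * growth G (γ x)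

/-- `(G, γ)` is an Omori-Yau pair for the Hessian, with the constants `A` (gradient bound) and
`C` (Hessian bound, in the sense of quadratic forms). -/
structure IsOmoriYauPairHess (G : ℝ → ℝ) (γ : W → ℝ) (A C : ℝ) : Prop
    extends IsOmoriYauPrePair E G γ A where
  hess_const_pos : 0 < C
  hess_le : ∃ K : Set W, IsCompact K ∧ ∀ x ∉ K, ∀ X : TangentSpace 𝓘(ℝ, E) x,
    hess E γ x X X ≤ C * √(G (γ x)) * growth G (γ x) * ‖X‖ ^ 2

/-- `(G, γ)` is an Omori-Yau pair for the Laplacian, with the constants `A` (gradient bound) and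
`B` (Laplacian bound). -/
structure IsOmoriYauPairLaplacian (G : ℝ → ℝ) (γ : W → ℝ) (A B : ℝ) : Prop
    extends IsOmoriYauPrePair E G γ A where
  laplacian_const_pos : 0 < B
  laplacian_le : ∃ K : Set W, IsCompact K ∧ ∀ x ∉ K,
    laplacian E γ x ≤ B * √(G (γ x)) * growth G (γ x)

end Pairs

end OmoriYau

end

/-!
If `u` attains its maximum, the maximum point serves for every `k`. Otherwise consider, for
`ε > 0`, the function `u - ε ψ(γ)`. It tends to `-∞` at infinity, because `u = o(ψ(γ))` and
`ψ(γ) → ∞`, so it is maximal at some point `x_ε`. As `u` exceeds somewhere its maximum over any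
given compact set `K`, the points `x_ε` lie outside `K` for all small `ε`. For a fixed `y`,
`u(x_ε) ≥ u(y) - ε ψ(γ(y))`, so that `u(x_ε) → sup u`.

As `G` is nondecreasing, `ψ` lies below its tangent line at `γ(x_ε)`, whose slope is
`1 / (√G I)` (`psi_le_tangent`). Hence `x_ε` is also a maximum point of `u - c γ` with
`c = ε / (√G(γ(x_ε)) I(γ(x_ε)))` (`exists_seq_isMaxOn_sub`). No derivative of `ψ` is then needed:
the first and second order conditions at `x_ε` read `∇u = c ∇γ` and `Hess u ≤ c Hess γ`
(`grad_eq_of_isLocalMax_sub`, `hess_le_of_isLocalMax_sub`), and the bounds on `∇γ`, `Hess γ`, `Δγ`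
outside `K` turn into bounds by `ε A`, `ε C`, `ε B`. The case of an attained maximum is `c = 0`.
-/

namespace OmoriYau

/-! ### The second derivative at a local maximum -/

/-- The second derivative is nonpositive at a local maximum: were it positive in some direction,
the restriction to that line would also have a local minimum, hence be locally constant. -/
theorem fderiv_fderiv_apply_nonpos_of_isLocalMax {E : Type*} [NormedAddCommGroup E]
    [NormedSpace ℝ E] {h : E → ℝ} {p : E} (hh : ContDiffAt ℝ 2 h p) (hmax : IsLocalMax h p)
    (w : E) : fderiv ℝ (fderiv ℝ h) p w w ≤ 0 := by
  have hline : ∀ s : ℝ, HasDerivAt (fun s : ℝ ↦ p + s • w) w s := fun s ↦ by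
    simpa using ((hasDerivAt_id s).smul_const w).const_add p
  have hlim : Tendsto (fun s : ℝ ↦ p + s • w) (𝓝 0) (𝓝 p) := by
    simpa using (hline 0).continuousAt.tendsto
  have hdiff : ∀ᶠ y in 𝓝 p, DifferentiableAt ℝ h y :=
    (hh.eventually (by simp)).mono fun y hy ↦ hy.differentiableAt (by simp)
  have hderiv : deriv (fun s : ℝ ↦ h (p + s • w)) =ᶠ[𝓝 0] fun s ↦ fderiv ℝ h (p + s • w) w := by
    filter_upwards [hlim.eventually hdiff] with s hs
    exact (hs.hasFDerivAt.comp_hasDerivAt s (hline s)).deriv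
  have hderiv2 : deriv (deriv fun s : ℝ ↦ h (p + s • w)) 0 = fderiv ℝ (fderiv ℝ h) p w w := by
    rw [hderiv.deriv_eq]
    have h1 : DifferentiableAt ℝ (fderiv ℝ h) (p + (0 : ℝ) • w) := by
      simpa using (hh.fderiv_right (m := 1) (by norm_num)).differentiableAt (by simp)
    have h2 : HasDerivAt (fun s : ℝ ↦ fderiv ℝ h (p + s • w))
        (fderiv ℝ (fderiv ℝ h) (p + (0 : ℝ) • w) w) 0 :=
      h1.hasFDerivAt.comp_hasDerivAt (0 : ℝ) (hline 0)
    have h3 : HasDerivAt (fun s : ℝ ↦ fderiv ℝ h (p + s • w) w)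
        (fderiv ℝ (fderiv ℝ h) (p + (0 : ℝ) • w) w w) 0 :=
      (ContinuousLinearMap.apply ℝ ℝ w).hasFDerivAt.comp_hasDerivAt (0 : ℝ) h2
    rw [h3.deriv, zero_smul, add_zero]
  have hmax' : IsLocalMax (fun s : ℝ ↦ h (p + s • w)) 0 := by
    simpa [IsLocalMax, IsMaxFilter] using hlim.eventually hmax
  by_contra! hpos
  have hcont : ContinuousAt (fun s : ℝ ↦ h (p + s • w)) 0 :=
    ContinuousAt.comp (by simpa using hh.continuousAt) (hline 0).continuousAt
  have hmin : IsLocalMin (fun s : ℝ ↦ h (p + s • w)) 0 :=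
    isLocalMin_of_deriv_deriv_pos (by rwa [hderiv2]) hmax'.deriv_eq_zero hcont
  have hconst : (fun s : ℝ ↦ h (p + s • w)) =ᶠ[𝓝 0] fun _ ↦ h (p + (0 : ℝ) • w) := by
    filter_upwards [hmin, hmax'] with s h1 h2 using le_antisymm h2 h1
  have hzero : deriv (deriv fun s : ℝ ↦ h (p + s • w)) 0 = 0 := by
    rw [hconst.deriv.deriv_eq]
    simp
  linarith

section Geometry

variable {E : Type*} [NormedAddCommGroup E] [NormedSpace ℝ E]
  {W : Type*} [TopologicalSpace W] [ChartedSpace E W]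

theorem contDiffAt_comp_extChartAt_symm {u : W → ℝ} {n : ℕ∞ω}
    (hu : ContMDiff 𝓘(ℝ, E) 𝓘(ℝ, ℝ) n u) (x : W) :
    ContDiffAt ℝ n (u ∘ (extChartAt 𝓘(ℝ, E) x).symm) (extChartAt 𝓘(ℝ, E) x x) := by
  have := (contMDiffAt_iff.1 (hu x)).2
  simpa only [extChartAt_model_space_eq_id, PartialEquiv.refl_coe, Function.id_comp,
    modelWithCornersSelf_coe, range_id, contDiffWithinAt_univ] using this

theorem mvfderiv_eq_fderiv_comp_extChartAt_symm {u : W → ℝ}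
    (hu : ContMDiff 𝓘(ℝ, E) 𝓘(ℝ, ℝ) 2 u) (x : W) (v : TangentSpace 𝓘(ℝ, E) x) :
    mvfderiv 𝓘(ℝ, E) u x v =
      fderiv ℝ (u ∘ (extChartAt 𝓘(ℝ, E) x).symm) (extChartAt 𝓘(ℝ, E) x x) v := by
  have hd : MDifferentiableAt 𝓘(ℝ, E) 𝓘(ℝ, ℝ) u x := (hu x).mdifferentiableAt (by simp)
  simp only [mvfderiv, mfderiv, hd, writtenInExtChartAt, extChartAt_model_space_eq_id]
  simp
  rfl

theorem isLocalMax_comp_extChartAt_symm {f : W → ℝ} {x : W} (hf : IsLocalMax f x) :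
    IsLocalMax (f ∘ (extChartAt 𝓘(ℝ, E) x).symm) (extChartAt 𝓘(ℝ, E) x x) := by
  have h1 : Tendsto (extChartAt 𝓘(ℝ, E) x).symm (𝓝 (extChartAt 𝓘(ℝ, E) x x)) (𝓝 x) := by
    simpa using (continuousAt_extChartAt_symm (I := 𝓘(ℝ, E)) x).tendsto
  simpa [IsLocalMax, IsMaxFilter] using h1.eventually hf

theorem mvfderiv_eq_of_isLocalMax_sub {u γ : W → ℝ} (hu : ContMDiff 𝓘(ℝ, E) 𝓘(ℝ, ℝ) 2 u)
    (hγ : ContMDiff 𝓘(ℝ, E) 𝓘(ℝ, ℝ) 2 γ) {c : ℝ} {x : W}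
    (hmax : IsLocalMax (fun y ↦ u y - c * γ y) x) :
    mvfderiv 𝓘(ℝ, E) u x = c • mvfderiv 𝓘(ℝ, E) γ x := by
  ext v
  have hU := (contDiffAt_comp_extChartAt_symm hu x).differentiableAt (by simp)
  have hΓ := (contDiffAt_comp_extChartAt_symm hγ x).differentiableAt (by simp)
  have h0 := (isLocalMax_comp_extChartAt_symm (E := E) hmax).fderiv_eq_zero
  have h1 := (hU.hasFDerivAt.sub (hΓ.hasFDerivAt.const_smul c)).fderiv
  have h2 := DFunLike.congr_fun (h1.symm.trans h0) v
  simp only [smul_apply, mvfderiv_eq_fderiv_comp_extChartAt_symm hu,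
    mvfderiv_eq_fderiv_comp_extChartAt_symm hγ]
  exact sub_eq_zero.1 h2

variable [FiniteDimensional ℝ E]
  [RiemannianBundle (fun x : W ↦ TangentSpace 𝓘(ℝ, E) x)]

theorem grad_eq_of_isLocalMax_sub {u γ : W → ℝ} (hu : ContMDiff 𝓘(ℝ, E) 𝓘(ℝ, ℝ) 2 u)
    (hγ : ContMDiff 𝓘(ℝ, E) 𝓘(ℝ, ℝ) 2 γ) {c : ℝ} {x : W}
    (hmax : IsLocalMax (fun y ↦ u y - c * γ y) x) : grad E u x = c • grad E γ x := by
  rw [grad, grad, mvfderiv_eq_of_isLocalMax_sub hu hγ hmax]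
  simp

variable [IsManifold 𝓘(ℝ, E) ∞ W]

/-- The Christoffel terms cancel, as the differentials of `u` and `c γ` agree at `x`; what remains
is the comparison of the second derivatives in the chart around `x`. -/
theorem hess_le_of_isLocalMax_sub {u γ : W → ℝ} (hu : ContMDiff 𝓘(ℝ, E) 𝓘(ℝ, ℝ) 2 u)
    (hγ : ContMDiff 𝓘(ℝ, E) 𝓘(ℝ, ℝ) 2 γ) {c : ℝ} {x : W}
    (hmax : IsLocalMax (fun y ↦ u y - c * γ y) x) (X : TangentSpace 𝓘(ℝ, E) x) :
    hess E u x X X ≤ c * hess E γ x X X := by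
  have hU := contDiffAt_comp_extChartAt_symm hu x
  have hΓ := contDiffAt_comp_extChartAt_symm hγ x
  have hdiff : ∀ {f : E → ℝ}, ContDiffAt ℝ 2 f (extChartAt 𝓘(ℝ, E) x x) →
      ∀ᶠ y in 𝓝 (extChartAt 𝓘(ℝ, E) x x), DifferentiableAt ℝ f y := fun hf ↦
    (hf.eventually (by simp)).mono fun y hy ↦ hy.differentiableAt (by simp)
  have hdiff2 : ∀ {f : E → ℝ}, ContDiffAt ℝ 2 f (extChartAt 𝓘(ℝ, E) x x) →
      DifferentiableAt ℝ (fderiv ℝ f) (extChartAt 𝓘(ℝ, E) x x) := fun hf ↦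
    (hf.fderiv_right (m := 1) (by norm_num)).differentiableAt (by simp)
  have hnonpos := fderiv_fderiv_apply_nonpos_of_isLocalMax
    (h := u ∘ (extChartAt 𝓘(ℝ, E) x).symm - c • (γ ∘ (extChartAt 𝓘(ℝ, E) x).symm))
    (hU.sub (hΓ.const_smul c))
    (isLocalMax_comp_extChartAt_symm (E := E) hmax) (chartCoord E x X)
  have heq : fderiv ℝ (u ∘ (extChartAt 𝓘(ℝ, E) x).symm - c • (γ ∘ (extChartAt 𝓘(ℝ, E) x).symm))
      =ᶠ[𝓝 (extChartAt 𝓘(ℝ, E) x x)] fderiv ℝ (u ∘ (extChartAt 𝓘(ℝ, E) x).symm)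
        - c • fderiv ℝ (γ ∘ (extChartAt 𝓘(ℝ, E) x).symm) := by
    filter_upwards [hdiff hU, hdiff hΓ] with y h1 h2
    exact (h1.hasFDerivAt.sub (h2.hasFDerivAt.const_smul c)).fderiv
  have h2 := ((hdiff2 hU).hasFDerivAt.sub ((hdiff2 hΓ).hasFDerivAt.const_smul c)).fderiv
  rw [heq.fderiv_eq, h2] at hnonpos
  simp only [sub_apply, smul_apply, smul_eq_mul] at hnonpos
  simp only [hess, mvfderiv_eq_of_isLocalMax_sub hu hγ hmax, smul_apply,
    smul_eq_mul, christoffel]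
  linarith

theorem laplacian_le_of_isLocalMax_sub {u γ : W → ℝ} (hu : ContMDiff 𝓘(ℝ, E) 𝓘(ℝ, ℝ) 2 u)
    (hγ : ContMDiff 𝓘(ℝ, E) 𝓘(ℝ, ℝ) 2 γ) {c : ℝ} {x : W}
    (hmax : IsLocalMax (fun y ↦ u y - c * γ y) x) :
    laplacian E u x ≤ c * laplacian E γ x := by
  rw [laplacian, laplacian, Finset.mul_sum]
  exact Finset.sum_le_sum fun i _ ↦ hess_le_of_isLocalMax_sub hu hγ hmax _

end Geometry

/-! ### The functions `I` and `ψ` -/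

section Growth

variable {G : ℝ → ℝ}

theorem continuousOn_one_div_sqrt (hG : ContinuousOn G (Ici 0)) (hpos : ∀ t, 0 ≤ t → 0 < G t) :
    ContinuousOn (fun s ↦ 1 / √(G s)) (Ici 0) :=
  continuousOn_const.div hG.sqrt fun s hs ↦ (Real.sqrt_pos.2 (hpos s hs)).ne'

theorem intervalIntegrable_one_div_sqrt (hG : ContinuousOn G (Ici 0))
    (hpos : ∀ t, 0 ≤ t → 0 < G t) {s t : ℝ} (hs : 0 ≤ s) (ht : 0 ≤ t) :
    IntervalIntegrable (fun s ↦ 1 / √(G s)) volume s t :=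
  ((continuousOn_one_div_sqrt hG hpos).mono fun _ hr ↦ (le_min hs ht).trans hr.1).intervalIntegrable

/-- The primitive `I` of the nonincreasing function `1 / √G` lies below its tangent lines. -/
theorem growth_sub_le (hG : ContinuousOn G (Ici 0)) (hpos : ∀ t, 0 ≤ t → 0 < G t)
    (hmono : MonotoneOn G (Ici 0)) {s t : ℝ} (hs : 0 ≤ s) (ht : 0 ≤ t) :
    growth G t - growth G s ≤ (1 / √(G s)) * (t - s) := by
  have hint {a b : ℝ} (ha : 0 ≤ a) (hb : 0 ≤ b) :=
    intervalIntegrable_one_div_sqrt hG hpos ha hb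
  have hanti : ∀ {a b : ℝ}, 0 ≤ a → a ≤ b → 1 / √(G b) ≤ 1 / √(G a) := fun ha hab ↦
    one_div_le_one_div_of_le (Real.sqrt_pos.2 (hpos _ ha))
      (Real.sqrt_le_sqrt (hmono ha (ha.trans hab) hab))
  have hsub : growth G t - growth G s = ∫ r in s..t, 1 / √(G r) := by
    rw [growth, growth, ← intervalIntegral.integral_interval_sub_left (hint le_rfl ht)
      (hint le_rfl hs)]
    ring
  rw [hsub]
  rcases le_total s t with hst | hts
  · have := intervalIntegral.integral_mono_on hst (hint hs ht)
      (intervalIntegrable_const (c := 1 / √(G s))) fun r hr ↦ hanti hs hr.1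
    simpa [mul_comm] using this
  · have := intervalIntegral.integral_mono_on hts (intervalIntegrable_const (c := 1 / √(G s)))
      (hint ht hs) fun r hr ↦ hanti (ht.trans hr.1) hr.2
    rw [intervalIntegral.integral_symm]
    simp only [intervalIntegral.integral_const, smul_eq_mul] at this
    linarith

theorem one_le_growth {t : ℝ} (ht : 0 ≤ t) : 1 ≤ growth G t := by
  have := intervalIntegral.integral_nonneg (μ := volume) (f := fun s ↦ 1 / √(G s)) ht
    fun s _ ↦ by positivity
  rw [growth]
  linarith

theorem psi_nonneg {t : ℝ} (ht : 0 ≤ t) : 0 ≤ psi G t :=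
  Real.log_nonneg (one_le_growth ht)

/-- `ψ` lies below its tangent lines, whose slopes are `1 / (√G I)`. -/
theorem psi_le_tangent (hG : ContinuousOn G (Ici 0)) (hpos : ∀ t, 0 ≤ t → 0 < G t)
    (hmono : MonotoneOn G (Ici 0)) {s t : ℝ} (hs : 0 ≤ s) (ht : 0 ≤ t) :
    psi G t ≤ psi G s + 1 / (√(G s) * growth G s) * (t - s) := by
  have hIs : 0 < growth G s := one_pos.trans_le (one_le_growth hs)
  have hIt : 0 < growth G t := one_pos.trans_le (one_le_growth ht)
  have hlog := Real.log_le_sub_one_of_pos (div_pos hIt hIs)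
  rw [Real.log_div hIt.ne' hIs.ne'] at hlog
  have h1 := div_le_div_of_nonneg_right (growth_sub_le hG hpos hmono hs ht) hIs.le
  have h2 : (growth G t - growth G s) / growth G s = growth G t / growth G s - 1 := by
    field_simp
  have h3 : 1 / √(G s) * (t - s) / growth G s = 1 / (√(G s) * growth G s) * (t - s) := by
    rw [div_mul_eq_mul_div, div_mul_eq_mul_div, div_div]
  rw [psi, psi]
  linarith

theorem continuousOn_psi (hG : ContinuousOn G (Ici 0)) (hpos : ∀ t, 0 ≤ t → 0 < G t)
    (hmono : MonotoneOn G (Ici 0)) : ContinuousOn (psi G) (Ici 0) := by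
  have hlip : LipschitzOnWith (Real.toNNReal (1 / √(G 0))) (growth G) (Ici 0) := by
    refine LipschitzOnWith.of_le_add_mul _ fun t ht s hs ↦ ?_
    have h0 : (0 : ℝ) ≤ 1 / √(G 0) := by positivity
    have h1 : 1 / √(G s) ≤ 1 / √(G 0) :=
      one_div_le_one_div_of_le (Real.sqrt_pos.2 (hpos 0 le_rfl))
        (Real.sqrt_le_sqrt (hmono self_mem_Ici hs hs))
    have h2 : 1 / √(G s) * (t - s) ≤ 1 / √(G 0) * dist t s :=
      (mul_le_mul_of_nonneg_left (le_abs_self _) (by positivity)).trans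
        (mul_le_mul_of_nonneg_right h1 (abs_nonneg _))
    rw [Real.coe_toNNReal _ h0]
    linarith [growth_sub_le hG hpos hmono hs ht]
  exact hlip.continuousOn.log fun t ht ↦ (one_pos.trans_le (one_le_growth ht)).ne'

theorem tendsto_psi_atTop
    (h : Tendsto (fun t : ℝ ↦ ∫ s in (0 : ℝ)..t, 1 / √(G s)) atTop atTop) :
    Tendsto (psi G) atTop atTop :=
  Real.tendsto_log_atTop.comp (tendsto_atTop_add_const_right _ 1 h)

end Growth

/-! ### The perturbed maximum principle -/

/-- If `u = o(q)` and `q → ∞` at infinity, and `u` does not attain its maximum, then `u - ε q` is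
maximal at points `x_k` outside a given compact set, for parameters `ε_k > 0` tending to `0`;
moreover `u(x_k) → sup u` if `u` is bounded above. -/
theorem exists_seq_isMaxOn_sub_mul {W : Type*} [TopologicalSpace W] [Nonempty W] {u q : W → ℝ}
    (hu : Continuous u) (hq : Continuous q) (hq0 : ∀ x, 0 ≤ q x)
    (hqt : Tendsto q (cocompact W) atTop)
    (hlim : Tendsto (fun x ↦ u x / q x) (cocompact W) (𝓝 0))
    (hnot : ∀ x, ∃ y, u x < u y) {K : Set W} (hK : IsCompact K) :
    ∃ (x : ℕ → W) (ε : ℕ → ℝ), (∀ k, 0 < ε k ∧ ε k ≤ 1 / ((k : ℝ) + 1) ∧ x k ∉ K ∧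
        ∀ y, u y - ε k * q y ≤ u (x k) - ε k * q (x k)) ∧
      (BddAbove (range u) → Tendsto (fun k ↦ u (x k)) atTop (𝓝 (⨆ y, u y))) := by
  have hmax : ∀ ε : ℝ, 0 < ε → ∃ x, ∀ y, u y - ε * q y ≤ u x - ε * q x := by
    intro ε hε
    refine Continuous.exists_forall_ge (f := fun x ↦ u x - ε * q x) (by fun_prop) ?_
    -- Near infinity `u ≤ (ε / 2) q`, hence `u - ε q ≤ -(ε / 2) q`.
    have hbot : Tendsto (fun x ↦ -(ε / 2 * q x)) (cocompact W) atBot :=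
      tendsto_neg_atTop_atBot.comp (hqt.const_mul_atTop (by positivity))
    refine tendsto_atBot_mono' _ ?_ hbot
    filter_upwards [hlim.eventually_lt_const (half_pos hε), hqt.eventually_gt_atTop 0] with x h1 h2
    have := (div_lt_iff₀ h2).1 h1
    linarith
  obtain ⟨δ, hδ, hout⟩ : ∃ δ : ℝ, 0 < δ ∧ ∀ ε, 0 < ε → ε ≤ δ → ∀ x,
      (∀ y, u y - ε * q y ≤ u x - ε * q x) → x ∉ K := by
    rcases K.eq_empty_or_nonempty with rfl | hne
    · exact ⟨1, one_pos, by simp⟩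
    obtain ⟨z, -, hz⟩ := hK.exists_isMaxOn hne hu.continuousOn
    obtain ⟨y, hy⟩ := hnot z
    -- With this `δ`, `δ q(y) < u(y) - u(z)`, where `u(z)` is the maximum of `u` over `K`.
    refine ⟨(u y - u z) / (q y + 1), div_pos (sub_pos.2 hy) (by linarith [hq0 y]), ?_⟩
    intro ε hε hεδ x hx hxK
    have h1 := hx y
    have h2 : u x ≤ u z := hz hxK
    have h3 := (le_div_iff₀ (by linarith [hq0 y])).1 hεδ
    nlinarith [mul_nonneg hε.le (hq0 x)]
  have hk : ∀ k : ℕ, (0 : ℝ) < min δ (1 / ((k : ℝ) + 1)) := fun k ↦ lt_min hδ (by positivity)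
  choose x hx using fun k ↦ hmax _ (hk k)
  refine ⟨x, fun k ↦ min δ (1 / ((k : ℝ) + 1)), fun k ↦ ⟨hk k, min_le_right _ _,
    hout _ (hk k) (min_le_left _ _) _ (hx k), hx k⟩, fun hb ↦ ?_⟩
  have hε : Tendsto (fun k : ℕ ↦ min δ (1 / ((k : ℝ) + 1))) atTop (𝓝 0) :=
    squeeze_zero (fun k ↦ (hk k).le) (fun k ↦ min_le_right _ _)
      tendsto_one_div_add_atTop_nhds_zero_nat
  refine tendsto_order.2 ⟨fun a ha ↦ ?_, fun a ha ↦ .of_forall fun k ↦ (le_ciSup hb _).trans_lt ha⟩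
  obtain ⟨y, hy⟩ := exists_lt_of_lt_ciSup ha
  have h1 : Tendsto (fun k : ℕ ↦ u y - min δ (1 / ((k : ℝ) + 1)) * q y) atTop (𝓝 (u y)) := by
    simpa using (hε.mul_const (q y)).const_sub (u y)
  filter_upwards [h1.eventually_const_lt hy] with k hk'
  linarith [hx k y, mul_nonneg (hk k).le (hq0 (x k))]

section PrePair

variable {E : Type*} [NormedAddCommGroup E] [NormedSpace ℝ E] [FiniteDimensional ℝ E]
  {W : Type*} [TopologicalSpace W] [ChartedSpace E W]
  [RiemannianBundle (fun x : W ↦ TangentSpace 𝓘(ℝ, E) x)]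
  {G : ℝ → ℝ} {γ : W → ℝ} {A : ℝ}

theorem IsOmoriYauPrePair.monotoneOn (h : IsOmoriYauPrePair E G γ A) : MonotoneOn G (Ici 0) := by
  refine monotoneOn_of_deriv_nonneg (convex_Ici 0) h.contDiffOn.continuousOn
    ((h.contDiffOn.differentiableOn (by simp)).mono interior_subset) fun t ht ↦ ?_
  rw [← derivWithin_of_mem_nhds (mem_interior_iff_mem_nhds.1 ht)]
  exact h.deriv_nonneg t (interior_subset ht)

/-- There are points `x_k` where `u - c_k γ` is maximal, for constants `c_k ≥ 0` such that
`c_k f ≤ D / k` for every number `f` that is at most `D √(G(γ(x_k))) I(γ(x_k))` if `x_k` lies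
outside the compact set `K`; moreover `u(x_k) → sup u` if `u` is bounded above. The number `f`
stands for `|∇γ|`, `Hess γ(X, X)` or `Δγ` at `x_k`. -/
theorem IsOmoriYauPrePair.exists_seq_isMaxOn_sub [Nonempty W] (h : IsOmoriYauPrePair E G γ A)
    {u : W → ℝ} (hu : Continuous u)
    (hlim : Tendsto (fun x ↦ u x / psi G (γ x)) (cocompact W) (𝓝 0)) {K : Set W}
    (hK : IsCompact K) :
    ∃ (x : ℕ → W) (c : ℕ → ℝ), (∀ k, 1 ≤ k → 0 ≤ c k ∧
        (∀ y, u y - c k * γ y ≤ u (x k) - c k * γ (x k)) ∧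
        ∀ D f : ℝ, 0 ≤ D → (x k ∉ K → f ≤ D * √(G (γ (x k))) * growth G (γ (x k))) →
          c k * f ≤ D / k) ∧
      (BddAbove (range u) → Tendsto (fun k ↦ u (x k)) atTop (𝓝 (⨆ y, u y))) := by
  by_cases hnot : ∀ x, ∃ y, u x < u y
  · have hG := h.contDiffOn.continuousOn
    have hψ : Continuous fun x ↦ psi G (γ x) :=
      (continuousOn_psi hG h.pos h.monotoneOn).comp_continuous h.contMDiff.continuous h.nonneg
    obtain ⟨x, ε, hx, hsup⟩ := exists_seq_isMaxOn_sub_mul hu hψ (fun x ↦ psi_nonneg (h.nonneg x))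
      ((tendsto_psi_atTop h.integral_eq_top).comp h.tendsto) hlim hnot hK
    refine ⟨x, fun k ↦ ε k * (1 / (√(G (γ (x k))) * growth G (γ (x k)))), fun k hk ↦ ?_, hsup⟩
    obtain ⟨hε, hεk, hxK, hmax⟩ := hx k
    have hpos : 0 < √(G (γ (x k))) * growth G (γ (x k)) :=
      mul_pos (Real.sqrt_pos.2 (h.pos _ (h.nonneg _)))
        (one_pos.trans_le (one_le_growth (h.nonneg _)))
    refine ⟨by positivity, fun y ↦ ?_, fun D f hD hf ↦ ?_⟩
    · have := mul_le_mul_of_nonneg_left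
        (psi_le_tangent hG h.pos h.monotoneOn (h.nonneg (x k)) (h.nonneg y)) hε.le
      linarith [hmax y]
    · have hk0 : (0 : ℝ) < k := by exact_mod_cast hk
      calc ε k * (1 / (√(G (γ (x k))) * growth G (γ (x k)))) * f
          ≤ ε k * (1 / (√(G (γ (x k))) * growth G (γ (x k)))) *
            (D * √(G (γ (x k))) * growth G (γ (x k))) := by
            have := hf hxK
            gcongr
        _ = ε k * D := by
            rw [mul_assoc D, mul_comm D, mul_assoc, ← mul_assoc (1 / _),
              one_div_mul_cancel hpos.ne', one_mul]
        _ ≤ 1 / k * D := by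
            refine mul_le_mul_of_nonneg_right (hεk.trans ?_) hD
            exact one_div_le_one_div_of_le hk0 (by linarith)
        _ = D / k := by ring
  · push Not at hnot
    obtain ⟨z, hz⟩ := hnot
    refine ⟨fun _ ↦ z, fun _ ↦ 0, fun k _ ↦ ⟨le_rfl, by simpa using hz, fun D f hD _ ↦ ?_⟩,
      fun hb ↦ ?_⟩
    · rw [zero_mul]
      positivity
    · rw [show ⨆ y, u y = u z from le_antisymm (ciSup_le hz) (le_ciSup hb z)]
      exact tendsto_const_nhds

end PrePair

end OmoriYau

theorem theorem4p5
    {E : Type*} [NormedAddCommGroup E] [NormedSpace ℝ E] [FiniteDimensional ℝ E]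
    {W : Type*} [EMetricSpace W] [ChartedSpace E W] [IsManifold 𝓘(ℝ, E) ∞ W]
    [RiemannianBundle (fun x : W ↦ TangentSpace 𝓘(ℝ, E) x)]
    [IsContMDiffRiemannianBundle 𝓘(ℝ, E) ∞ E (fun x : W ↦ TangentSpace 𝓘(ℝ, E) x)]
    [IsRiemannianManifold 𝓘(ℝ, E) W] [CompleteSpace W] [Nonempty W]
    (G : ℝ → ℝ) (γ : W → ℝ) (u : W → ℝ)
    (hu : ContMDiff 𝓘(ℝ, E) 𝓘(ℝ, ℝ) 2 u)
    (hlim : Tendsto (fun x ↦ u x / OmoriYau.psi G (γ x)) (cocompact W) (𝓝 0)) :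
    (∀ A C : ℝ, OmoriYau.IsOmoriYauPairHess E G γ A C →
      ∃ x : ℕ → W,
        (∀ k : ℕ, 1 ≤ k → ‖OmoriYau.grad E u (x k)‖ ≤ A / k ∧
          ∀ X : TangentSpace 𝓘(ℝ, E) (x k), OmoriYau.hess E u (x k) X X ≤ C / k * ‖X‖ ^ 2) ∧
        (BddAbove (range u) → Tendsto (fun k ↦ u (x k)) atTop (𝓝 (⨆ y, u y)))) ∧
    (∀ A B : ℝ, OmoriYau.IsOmoriYauPairLaplacian E G γ A B →
      ∃ x : ℕ → W,
        (∀ k : ℕ, 1 ≤ k → ‖OmoriYau.grad E u (x k)‖ ≤ A / k ∧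
          OmoriYau.laplacian E u (x k) ≤ B / k) ∧
        (BddAbove (range u) → Tendsto (fun k ↦ u (x k)) atTop (𝓝 (⨆ y, u y)))) := by
  have hgrad {c : ℝ} {x : W} (hγ : ContMDiff 𝓘(ℝ, E) 𝓘(ℝ, ℝ) 2 γ) (hc : 0 ≤ c)
      (hmax : IsLocalMax (fun y ↦ u y - c * γ y) x) :
      ‖OmoriYau.grad E u x‖ = c * ‖OmoriYau.grad E γ x‖ := by
    rw [OmoriYau.grad_eq_of_isLocalMax_sub hu hγ hmax, norm_smul, Real.norm_of_nonneg hc]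
  refine ⟨fun A C h ↦ ?_, fun A B h ↦ ?_⟩
  · obtain ⟨K₁, hK₁, hA⟩ := h.grad_le
    obtain ⟨K₂, hK₂, hC⟩ := h.hess_le
    obtain ⟨x, c, hx, hsup⟩ :=
      h.toIsOmoriYauPrePair.exists_seq_isMaxOn_sub hu.continuous hlim (hK₁.union hK₂)
    refine ⟨x, fun k hk ↦ ?_, hsup⟩
    obtain ⟨hc, hmax, hle⟩ := hx k hk
    have hloc : IsLocalMax (fun y ↦ u y - c k * γ y) (x k) := .of_forall hmax
    refine ⟨?_, fun X ↦ ?_⟩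
    · rw [hgrad h.contMDiff hc hloc]
      exact hle A _ h.const_pos.le fun hK ↦ hA _ fun h' ↦ hK (.inl h')
    · refine (OmoriYau.hess_le_of_isLocalMax_sub hu h.contMDiff hloc X).trans ?_
      rw [div_mul_eq_mul_div]
      refine hle (C * ‖X‖ ^ 2) _ (mul_nonneg h.hess_const_pos.le (sq_nonneg _)) fun hK ↦ ?_
      exact (hC _ (fun h' ↦ hK (.inr h')) X).trans_eq (by ring)
  · obtain ⟨K₁, hK₁, hA⟩ := h.grad_le
    obtain ⟨K₂, hK₂, hB⟩ := h.laplacian_le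
    obtain ⟨x, c, hx, hsup⟩ :=
      h.toIsOmoriYauPrePair.exists_seq_isMaxOn_sub hu.continuous hlim (hK₁.union hK₂)
    refine ⟨x, fun k hk ↦ ?_, hsup⟩
    obtain ⟨hc, hmax, hle⟩ := hx k hk
    have hloc : IsLocalMax (fun y ↦ u y - c k * γ y) (x k) := .of_forall hmax
    constructor
    · rw [hgrad h.contMDiff hc hloc]
      exact hle A _ h.const_pos.le fun hK ↦ hA _ fun h' ↦ hK (.inl h')
    · refine (OmoriYau.laplacian_le_of_isLocalMax_sub hu h.contMDiff hloc).trans ?_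
      exact hle B _ h.laplacian_const_pos.le fun hK ↦ hB _ fun h' ↦ hK (.inr h')
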